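/- Theorem 3.9. Write $(a)_0=1$ and $(a)_k=a(a+1)\cdots(a+k-1)$. Let $N\ge 0$ and $0\le n\le N$ be integers and let $\alpha,\beta>-1$ be real numbers with $N+1+\beta-\alpha\ge 0$. Let $R_n(\cdot,\alpha,\beta,N)$ be the dual Hahn polynomial, that is, the polynomial of degree $n$ with $$R_n\bigl(y(y+\alpha+\beta+1),\alpha,\beta,N\bigr)=\sum_{k=0}^{n}\frac{(-n)_k\,(-y)_k\,(y+\alpha+\beta+1)_k}{k!\,(\alpha+1)_k\,(-N)_k}\qquad\text{for all } y\in\mathbb R;$$ equivalently, the unique polynomial of degree at most $N$ whose value at $y(y+\alpha+\beta+1)$, for $y=0,1,\dots,N$, is the value $Q_y(n,\alpha,\beta,N)$ at the point $n$ of the Hahn polynomial $Q_y(x,\alpha,\beta,N)=\sum_{k=0}^{y}\frac{(-y)_k\,(y+\alpha+\beta+1)_k\,(-x)_k}{k!\,(\alpha+1)_k\,(-N)_k}$. If $$n\le \tfrac12\min\{N+2,\;N+1+\beta-\alpha\},$$ then for all $x\in[0,N(N+\alpha+\beta+1)]$ $$|R_n(x,\alpha,\beta,N)|\le \frac{(N+1+\beta-n)_n}{(\alpha+1)_n}=\bigl|R_n\bigl(N(N+\alpha+\beta+1),\alpha,\beta,N\bigr)\bigr|.$$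 -/

import Mathlib

open Polynomial Finset

noncomputable section

/-- The Pochhammer symbol `(a)_k = a (a + 1) ⋯ (a + k - 1)`, with `(a)_0 = 1`. -/
def poch (a : ℝ) (k : ℕ) : ℝ := (ascPochhammer ℝ k).eval a

/-- The Hahn polynomial
`Q_n(x, α, β, N) = ∑_{k=0}^n (-n)_k (n+α+β+1)_k (-x)_k / (k! (α+1)_k (-N)_k)`,
meaningful for `n ≤ N` and `α, β > -1`. -/
def hahn (N : ℕ) (α β : ℝ) (n : ℕ) (x : ℝ) : ℝ :=
  ∑ k ∈ range (n + 1),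
    poch (-n) k * poch (n + α + β + 1) k * poch (-x) k /
      (k.factorial * poch (α + 1) k * poch (-N) k)

/-- The nodes `λ_x = x (x + α + β + 1)` of the dual Hahn polynomials. -/
def dualHahnNode (α β : ℝ) (x : ℝ) : ℝ := x * (x + α + β + 1)

/-- The dual Hahn polynomial `R_n(·, α, β, N)`, for `n ≤ N` and `α, β > -1`: the polynomial
of degree `n` in the variable `λ = x (x + α + β + 1)` given by
`∑_{k=0}^n (-n)_k (-x)_k (x+α+β+1)_k / (k! (α+1)_k (-N)_k)`, where
`(-x)_k (x+α+β+1)_k = ∏_{j<k} (j (j+α+β+1) - λ)`.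
By `eq_dualHahn_iff` below it is the unique polynomial of degree at most `N` with
`R_n(λ_x) = Q_x(n, α, β, N)` for `x = 0, …, N`. -/
def dualHahn (N : ℕ) (α β : ℝ) (n : ℕ) : ℝ[X] :=
  ∑ k ∈ range (n + 1),
    C (poch (-n) k / (k.factorial * poch (α + 1) k * poch (-N) k)) *
      ∏ j ∈ range k, (C (dualHahnNode α β j) - X)

theorem poch_succ (a : ℝ) (k : ℕ) : poch a (k + 1) = poch a k * (a + k) :=
  ascPochhammer_succ_eval k a

theorem poch_neg_eq_zero {n k : ℕ} (h : n < k) : poch (-n) k = 0 := by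
  simpa [poch] using ascPochhammer_eval_neg_coe_nat_of_lt (R := ℝ) h

theorem prod_node_sub (α β x : ℝ) (k : ℕ) :
    ∏ j ∈ range k, (dualHahnNode α β j - dualHahnNode α β x) =
      poch (-x) k * poch (x + α + β + 1) k := by
  induction k with
  | zero => simp [poch]
  | succ k ih =>
    rw [prod_range_succ, ih, poch_succ, poch_succ, dualHahnNode, dualHahnNode]
    ring

/-- The defining relation `R_n(λ_x) = Q_x(n, α, β, N)`. -/
theorem dualHahn_eval_node (N : ℕ) (α β : ℝ) (n x : ℕ) :
    (dualHahn N α β n).eval (dualHahnNode α β x) = hahn N α β x n := by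
  have e1 : (dualHahn N α β n).eval (dualHahnNode α β x) =
      ∑ k ∈ range (n + 1), poch (-x) k * poch (x + α + β + 1) k * poch (-n) k /
        (k.factorial * poch (α + 1) k * poch (-N) k) := by
    rw [dualHahn, eval_finsetSum]
    refine sum_congr rfl fun k _ => ?_
    rw [eval_mul, eval_C, eval_prod]
    simp only [eval_sub, eval_C, eval_X]
    rw [prod_node_sub]
    ring
  rw [e1, hahn]
  have key : ∀ m : ℕ, (∀ k, m < k → poch (-x) k * poch (x + α + β + 1) k * poch (-n) k /
        (k.factorial * poch (α + 1) k * poch (-N) k) = 0) → m ≤ n + x →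
      ∑ k ∈ range (m + 1), poch (-x) k * poch (x + α + β + 1) k * poch (-n) k /
        (k.factorial * poch (α + 1) k * poch (-N) k) =
      ∑ k ∈ range (n + x + 1), poch (-x) k * poch (x + α + β + 1) k * poch (-n) k /
        (k.factorial * poch (α + 1) k * poch (-N) k) := by
    intro m hm hmn
    refine sum_subset (range_subset_range.2 (by omega)) fun k _ hk => hm k ?_
    simpa using hk
  rw [key n (fun k hk => by rw [poch_neg_eq_zero hk]; simp) (by omega),
    key x (fun k hk => by rw [poch_neg_eq_zero hk]; simp) (by omega)]

theorem natDegree_dualHahn_le (N : ℕ) (α β : ℝ) (n : ℕ) :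
    (dualHahn N α β n).natDegree ≤ n := by
  refine natDegree_sum_le_of_forall_le _ _ fun k hk => ?_
  refine (natDegree_C_mul_le _ _).trans ((natDegree_prod_le _ _).trans ?_)
  calc ∑ j ∈ range k, (C (dualHahnNode α β j) - X : ℝ[X]).natDegree
      ≤ ∑ _j ∈ range k, 1 := sum_le_sum fun j _ => by
        refine (natDegree_sub_le _ _).trans ?_
        simp
    _ = k := by simp
    _ ≤ n := by have := mem_range.1 hk; omega

/-- The dual Hahn polynomial is determined by its relation to the Hahn polynomials. -/
theorem eq_dualHahn_iff {N n : ℕ} {α β : ℝ} (hα : -1 < α) (hβ : -1 < β) (hn : n ≤ N)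
    {P : ℝ[X]} (hP : P.natDegree ≤ N) :
    P = dualHahn N α β n ↔
      ∀ x : ℕ, x ≤ N → P.eval (dualHahnNode α β x) = hahn N α β x n := by
  constructor
  · rintro rfl x -
    exact dualHahn_eval_node N α β n x
  · intro h
    have hinj : Function.Injective fun x : Fin (N + 1) => dualHahnNode α β (x : ℕ) := by
      have aux : ∀ a b : ℕ, a < b → dualHahnNode α β a < dualHahnNode α β b := by
        intro a b hab
        have h1 : (a : ℝ) + 1 ≤ b := by exact_mod_cast hab
        have h2 : (0 : ℝ) ≤ a := a.cast_nonneg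
        unfold dualHahnNode
        nlinarith [mul_pos (show (0 : ℝ) < b - a by linarith)
          (show (0 : ℝ) < b + a + α + β + 1 by linarith)]
      intro a b hab
      rcases lt_trichotomy (a : ℕ) b with h1 | h1 | h1
      · exact absurd hab (aux _ _ h1).ne
      · exact Fin.ext h1
      · exact absurd hab (aux _ _ h1).ne'
    refine eq_of_natDegree_lt_card_of_eval_eq P _ hinj (fun x => ?_) ?_
    · rw [h x (by omega), dualHahn_eval_node]
    · have := natDegree_dualHahn_le N α β n
      simp only [Fintype.card_fin]
      omega

end

theorem poch_zero (a : ℝ) : poch a 0 = 1 := by simp [poch]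

theorem poch_succ_left (a : ℝ) (k : ℕ) : poch a (k + 1) = a * poch (a + 1) k := by
  simp [poch, ascPochhammer_succ_left]

theorem poch_pos {a : ℝ} (ha : 0 < a) (k : ℕ) : 0 < poch a k := ascPochhammer_pos k a ha

theorem poch_neg_natCast_ne_zero {N k : ℕ} (h : k ≤ N) : poch (-N) k ≠ 0 := by
  induction k with
  | zero => simp [poch_zero]
  | succ k ih =>
    rw [poch_succ]
    have h1 : (k : ℝ) + 1 ≤ N := by exact_mod_cast h
    exact mul_ne_zero (ih (by omega)) (by linarith)

theorem poch_neg_natCast (n k : ℕ) :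
    poch (-n) k = (-1) ^ k * (k.factorial * n.choose k) := by
  induction k with
  | zero => simp [poch_zero]
  | succ k ih =>
    rw [poch_succ, ih, Nat.factorial_succ]
    rcases le_or_gt k n with h | h
    · have h1 : ((n.choose (k + 1) * (k + 1) : ℕ) : ℝ) = (n.choose k * (n - k) : ℕ) := by
        rw [Nat.choose_succ_right_eq]
      push_cast [h] at h1 ⊢
      rw [pow_succ]
      linear_combination (-1 : ℝ) ^ k * k.factorial * h1
    · rw [Nat.choose_eq_zero_of_lt h, Nat.choose_eq_zero_of_lt (by omega)]
      simp

/-! ### The three-term recurrence in `n`. -/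

/-- The coefficient of `∏_{j<k} (λ_j - λ)` in the dual Hahn polynomial, in binomial form. -/
noncomputable def dualHahnCoeff (N : ℕ) (α : ℝ) (n k : ℕ) : ℝ :=
  (-1) ^ k * n.choose k / (poch (α + 1) k * poch (-N) k)

/-- The basis `∏_{j<k} (λ_j - λ)`. -/
noncomputable def nodeProd (α β l : ℝ) (k : ℕ) : ℝ := ∏ j ∈ range k, (dualHahnNode α β j - l)

theorem nodeProd_succ (α β l : ℝ) (k : ℕ) :
    l * nodeProd α β l k = dualHahnNode α β k * nodeProd α β l k - nodeProd α β l (k + 1) := by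
  rw [nodeProd, nodeProd, prod_range_succ]
  ring

theorem dualHahn_eval_eq_sum (N : ℕ) (α β : ℝ) {n m : ℕ} (h : n ≤ m) (l : ℝ) :
    (dualHahn N α β n).eval l =
      ∑ k ∈ range (m + 1), dualHahnCoeff N α n k * nodeProd α β l k := by
  have e : (dualHahn N α β n).eval l =
      ∑ k ∈ range (n + 1), dualHahnCoeff N α n k * nodeProd α β l k := by
    rw [dualHahn, eval_finsetSum]
    refine sum_congr rfl fun k _ => ?_
    rw [eval_mul, eval_C, eval_prod]
    simp only [eval_sub, eval_C, eval_X]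
    have hk : (k.factorial : ℝ) ≠ 0 := by exact_mod_cast k.factorial_ne_zero
    rw [nodeProd, dualHahnCoeff, poch_neg_natCast n k, mul_assoc (k.factorial : ℝ),
      mul_left_comm, mul_div_mul_left _ _ hk]
  rw [e]
  refine sum_subset (range_subset_range.2 (by omega)) fun k _ hk => ?_
  have : n < k := by simpa using hk
  simp [dualHahnCoeff, Nat.choose_eq_zero_of_lt this]

/-- Compares coefficients of `nodeProd` at index `k + 1` in the three-term recurrence. Once the
Pochhammer factors are cleared, only Pascal's rule and the absorption identities for binomials
remain. -/
theorem dualHahnCoeff_recurrence {N n k : ℕ} {α : ℝ} (β : ℝ) (hα : -1 < α) (hk : k + 1 ≤ N) :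
    dualHahnNode α β (k + 1 : ℕ) * dualHahnCoeff N α (n + 1) (k + 1)
        - dualHahnCoeff N α (n + 1) k =
      (n + 1 + α + 1) * (N - (n + 1)) *
          (dualHahnCoeff N α (n + 1) (k + 1) - dualHahnCoeff N α (n + 2) (k + 1)) -
        (n + 1) * (N + β - n) *
          (dualHahnCoeff N α n (k + 1) - dualHahnCoeff N α (n + 1) (k + 1)) := by
  have h1 : poch (α + 1) k ≠ 0 := (poch_pos (by linarith) k).ne'
  have h2 : poch (-N) k ≠ 0 := poch_neg_natCast_ne_zero (by omega)
  have h3 : α + 1 + k ≠ 0 := by have := k.cast_nonneg (α := ℝ); linarith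
  have hk' : (k : ℝ) + 1 ≤ N := by exact_mod_cast hk
  have h4 : -(N : ℝ) + k ≠ 0 := by linarith
  have c1 : ((n + 2).choose (k + 1) : ℝ) = (n + 1).choose k + (n + 1).choose (k + 1) := by
    exact_mod_cast Nat.choose_succ_succ (n + 1) k
  have c2 : ((n + 1).choose (k + 1) : ℝ) = n.choose k + n.choose (k + 1) := by
    exact_mod_cast Nat.choose_succ_succ n k
  have c3 : ((n : ℝ) + 1) * n.choose k = (n + 1).choose (k + 1) * (k + 1) := by
    exact_mod_cast Nat.add_one_mul_choose_eq n k
  have c4 : ((n + 1).choose (k + 1) : ℝ) * (k + 1) = (n + 1).choose k * (n + 1 - k) := by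
    rcases le_or_gt k (n + 1) with h | h
    · have := Nat.choose_succ_right_eq (n + 1) k
      have h5 : (((n + 1).choose (k + 1) * (k + 1) : ℕ) : ℝ) =
        ((n + 1).choose k * (n + 1 - k) : ℕ) := by rw [this]
      push_cast [h] at h5
      exact h5
    · rw [Nat.choose_eq_zero_of_lt h, Nat.choose_eq_zero_of_lt (by omega)]
      simp
  simp only [dualHahnCoeff, dualHahnNode, poch_succ, c1, pow_succ]
  push_cast
  field_simp
  have c2' : (n.choose (k + 1) : ℝ) = (n + 1).choose (k + 1) - n.choose k := by linarith
  rw [c2']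
  linear_combination ((N : ℝ) + β - n) * c3 - ((k : ℝ) + 1 + α + β + 1 - (N + β - n)) * c4

theorem dualHahn_eval_zero (N : ℕ) (α β l : ℝ) : (dualHahn N α β 0).eval l = 1 := by
  simp [dualHahn, poch_zero]

theorem dualHahn_eval_one {N : ℕ} {α : ℝ} (β : ℝ) (l : ℝ) :
    (dualHahn N α β 1).eval l = 1 - l / ((α + 1) * N) := by
  simp [dualHahn, sum_range_succ, poch_zero, poch_succ, dualHahnNode, div_eq_mul_inv]
  ring

theorem dualHahn_recurrence {N n : ℕ} {α : ℝ} (β : ℝ) (hα : -1 < α) (hn : n + 2 ≤ N) (l : ℝ) :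
    l * (dualHahn N α β (n + 1)).eval l =
      (n + 1 + α + 1) * (N - (n + 1)) *
          ((dualHahn N α β (n + 1)).eval l - (dualHahn N α β (n + 2)).eval l) -
        (n + 1) * (N + β - n) *
          ((dualHahn N α β n).eval l - (dualHahn N α β (n + 1)).eval l) := by
  have hlhs : l * (dualHahn N α β (n + 1)).eval l = ∑ k ∈ range (n + 2),
      (dualHahnNode α β (k + 1 : ℕ) * dualHahnCoeff N α (n + 1) (k + 1)
        - dualHahnCoeff N α (n + 1) k) * nodeProd α β l (k + 1) := by
    have e1 : l * (dualHahn N α β (n + 1)).eval l =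
        ∑ k ∈ range (n + 3), dualHahnNode α β k * dualHahnCoeff N α (n + 1) k *
          nodeProd α β l k -
        ∑ k ∈ range (n + 2), dualHahnCoeff N α (n + 1) k * nodeProd α β l (k + 1) := by
      have e2 : ∑ k ∈ range (n + 3), dualHahnNode α β k * dualHahnCoeff N α (n + 1) k *
          nodeProd α β l k = ∑ k ∈ range (n + 2), dualHahnNode α β k *
          dualHahnCoeff N α (n + 1) k * nodeProd α β l k := by
        rw [sum_range_succ _ (n + 2)]
        simp [dualHahnCoeff]
      rw [e2, dualHahn_eval_eq_sum N α β (le_refl (n + 1)), mul_sum, ← sum_sub_distrib]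
      refine sum_congr rfl fun k _ => ?_
      linear_combination dualHahnCoeff N α (n + 1) k * nodeProd_succ α β l k
    rw [e1, sum_range_succ' _ (n + 2)]
    simp only [sub_mul, sum_sub_distrib]
    simp [dualHahnNode]
  rw [hlhs, dualHahn_eval_eq_sum N α β (show n ≤ n + 2 by omega),
    dualHahn_eval_eq_sum N α β (show n + 1 ≤ n + 2 by omega),
    dualHahn_eval_eq_sum N α β (le_refl (n + 2)), ← sum_sub_distrib, ← sum_sub_distrib,
    mul_sum, mul_sum, ← sum_sub_distrib, sum_range_succ' _ (n + 2)]
  have h0 : ∀ m, dualHahnCoeff N α m 0 = 1 := fun m => by simp [dualHahnCoeff, poch_zero]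
  -- The recurrence involves only differences of consecutive `R_n` on the right, so the constant
  -- terms cancel.
  simp only [h0, sub_self, mul_zero, add_zero]
  refine sum_congr rfl fun k hk => ?_
  have hk' := mem_range.1 hk
  rw [dualHahnCoeff_recurrence β hα (by omega)]
  ring

/-! ### Normalization at `λ_N` and the first-order system. -/

/-- The value `R_n(λ_N)`, as a signed product. -/
noncomputable def dualHahnTop (N : ℕ) (α β : ℝ) : ℕ → ℝ
  | 0 => 1
  | n + 1 => -((N + β - n) / (n + 1 + α)) * dualHahnTop N α β n

/-- The pair `(P_n, K_n)`, where `P_n = R_n / R_n(λ_N)` in the variable `s = λ / N`, and `K_n` is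
its companion in a trigonometric-type identity `P_n² + s (N + α + β + 1 - s) K_n² / n² ≤ 1`. -/
noncomputable def dualHahnLadder (N : ℕ) (α β s : ℝ) : ℕ → ℝ × ℝ
  | 0 => (1, 0)
  | n + 1 =>
    let q := dualHahnLadder N α β s n
    (((s - (n + 1 + α)) * q.1 - s * (N + α + β + 1 - s) * (q.2 / (N - n))) / (N + β - n),
      (n + 1) * (q.1 - (N + β - n - s) * (q.2 / (N - n))) / (N + β - n))

/-- Used to eliminate `K_{n+1}` from the next ladder step, which leaves a second-order recurrence
for `P_n` alone. -/
theorem dualHahnLadder_relation {N n : ℕ} {α β : ℝ} (hβ : -1 < β) (hn : n + 1 ≤ N) (s : ℝ) :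
    s * (N + α + β + 1 - s) * (dualHahnLadder N α β s (n + 1)).2 =
      (n + 1) * ((n + 1 + α) * (dualHahnLadder N α β s n).1 +
        (N + β - n - s) * (dualHahnLadder N α β s (n + 1)).1) := by
  have hn' : (n : ℝ) + 1 ≤ N := by exact_mod_cast hn
  have hB : (N : ℝ) + β - n ≠ 0 := by linarith
  have hM : (N : ℝ) - n ≠ 0 := by linarith
  simp only [dualHahnLadder]
  field_simp
  ring

/-- Two consecutive indices are carried because the recurrence has order two. -/
theorem dualHahn_eval_eq_ladder {N : ℕ} {α β : ℝ} (hα : -1 < α) (hβ : -1 < β) (s : ℝ) (n : ℕ)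
    (hn : n + 1 ≤ N) :
    (dualHahn N α β n).eval (N * s) = dualHahnTop N α β n * (dualHahnLadder N α β s n).1 ∧
    (dualHahn N α β (n + 1)).eval (N * s) =
      dualHahnTop N α β (n + 1) * (dualHahnLadder N α β s (n + 1)).1 := by
  induction n with
  | zero =>
    have hN : (1 : ℝ) ≤ N := by exact_mod_cast hn
    refine ⟨by simp [dualHahn_eval_zero, dualHahnTop, dualHahnLadder], ?_⟩
    have hB : (N : ℝ) + β ≠ 0 := by linarith
    have hA : α + 1 ≠ 0 := by linarith
    have hA' : 1 + α ≠ 0 := by linarith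
    have hN0 : (N : ℝ) ≠ 0 := by linarith
    rw [dualHahn_eval_one]
    simp [dualHahnTop, dualHahnLadder]
    field_simp
    ring
  | succ n ih =>
    obtain ⟨h1, h2⟩ := ih (by omega)
    refine ⟨h2, ?_⟩
    have hn' : (n : ℝ) + 1 + 1 ≤ N := by exact_mod_cast hn
    have hn0 : (0 : ℝ) ≤ n := n.cast_nonneg
    have hB : (N : ℝ) + β - n ≠ 0 := by linarith
    have hB' : (N : ℝ) + β - (n + 1) ≠ 0 := by linarith
    have hM : (N : ℝ) - (n + 1) ≠ 0 := by linarith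
    have hA : (n : ℝ) + 1 + α ≠ 0 := by linarith
    have hA' : (n : ℝ) + 1 + 1 + α ≠ 0 := by linarith
    have hrec := dualHahn_recurrence β hα (n := n) (by omega) (N * s)
    have hrel := dualHahnLadder_relation (N := N) (n := n) (α := α) hβ (by omega) s
    have hP : (N + β - (n + 1)) * (N - (n + 1)) * (dualHahnLadder N α β s (n + 2)).1 =
        (N - (n + 1)) * (s - (n + 1 + 1 + α)) * (dualHahnLadder N α β s (n + 1)).1 -
          s * (N + α + β + 1 - s) * (dualHahnLadder N α β s (n + 1)).2 := by
      rw [dualHahnLadder]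
      push_cast
      field_simp
    have ht1 : (n + 1 + α) * dualHahnTop N α β (n + 1) =
        -((N + β - n) * dualHahnTop N α β n) := by
      rw [dualHahnTop]; field_simp
    have ht2 : (n + 1 + 1 + α) * dualHahnTop N α β (n + 2) =
        -((N + β - (n + 1)) * dualHahnTop N α β (n + 1)) := by
      rw [dualHahnTop]; push_cast; field_simp
    rw [h1, h2] at hrec
    refine mul_left_cancel₀ (mul_ne_zero hA' hM) ?_
    change _ = ((n : ℝ) + 1 + 1 + α) * (N - (n + 1)) *
      (dualHahnTop N α β (n + 2) * (dualHahnLadder N α β s (n + 2)).1)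
    have : (dualHahn N α β (n + 1 + 1)) = dualHahn N α β (n + 2) := rfl
    rw [this]
    generalize dualHahnTop N α β n = t0 at *
    generalize dualHahnTop N α β (n + 1) = t1 at *
    generalize dualHahnTop N α β (n + 2) = t2 at *
    generalize (dualHahnLadder N α β s n).1 = p0 at *
    generalize dualHahnLadder N α β s (n + 1) = p1 at *
    generalize (dualHahnLadder N α β s (n + 2)).1 = p2 at *
    linear_combination hrec - (N - (n + 1)) * p2 * ht2 + t1 * hP - t1 * hrel
      - (n + 1) * p0 * ht1

theorem dualHahn_eval_eq_top_mul {N n : ℕ} {α β : ℝ} (hα : -1 < α) (hβ : -1 < β) (s : ℝ)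
    (hn : n ≤ N) :
    (dualHahn N α β n).eval (N * s) = dualHahnTop N α β n * (dualHahnLadder N α β s n).1 := by
  cases n with
  | zero => simp [dualHahn_eval_zero, dualHahnTop, dualHahnLadder]
  | succ n => exact (dualHahn_eval_eq_ladder hα hβ s n hn).2

/-! ### Energy decay. -/

/-- One step of the trigonometric-type identity. -/
theorem dualHahnLadder_energy {N n : ℕ} {α β : ℝ} (hβ : -1 < β) (hn : n + 1 ≤ N) (s : ℝ) :
    (dualHahnLadder N α β s (n + 1)).1 ^ 2 + s * (N + α + β + 1 - s) *
        ((dualHahnLadder N α β s (n + 1)).2 / (n + 1)) ^ 2 =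
      (dualHahnLadder N α β s n).1 ^ 2 + s * (N + α + β + 1 - s) *
        ((dualHahnLadder N α β s n).2 / (N - n)) ^ 2 -
      (N + 1 + β - α - 2 * (n + 1)) * (N + α + β + 1 - s) / (N + β - n) ^ 2 *
        ((dualHahnLadder N α β s n).1 + s * ((dualHahnLadder N α β s n).2 / (N - n))) ^ 2 := by
  have hn' : (n : ℝ) + 1 ≤ N := by exact_mod_cast hn
  have hB : (N : ℝ) + β - n ≠ 0 := by linarith
  have hn1 : (n : ℝ) + 1 ≠ 0 := by positivity
  simp only [dualHahnLadder]
  -- In terms of `P_n` and `v` a ladder step is linear with sole denominator `N + β - n`, so the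
  -- claim is a quadratic identity in `P_n` and `v`.
  generalize (dualHahnLadder N α β s n).2 / (N - n) = v
  field_simp
  ring

theorem dualHahnLadder_energy_le_one {N n : ℕ} {α β s : ℝ} (hβ : -1 < β)
    (hs : 0 ≤ s) (hs' : s ≤ N + α + β + 1) (hnN : n ≤ N) (h1 : 2 * n ≤ N + 2)
    (h2 : 2 * (n : ℝ) ≤ N + 1 + β - α) :
    (dualHahnLadder N α β s n).1 ^ 2 + s * (N + α + β + 1 - s) *
        ((dualHahnLadder N α β s n).2 / n) ^ 2 ≤ 1 := by
  induction n with
  | zero => simp [dualHahnLadder]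
  | succ n ih =>
    push_cast at h2 ⊢
    have hL : 0 ≤ N + α + β + 1 - s := by linarith
    have ih' := ih (by omega) (by omega) (by linarith)
    rw [dualHahnLadder_energy hβ hnN]
    have hD : 0 ≤ (N + 1 + β - α - 2 * (n + 1)) * (N + α + β + 1 - s) / (N + β - n) ^ 2 *
        ((dualHahnLadder N α β s n).1 + s * ((dualHahnLadder N α β s n).2 / (N - n))) ^ 2 := by
      have : 0 ≤ N + 1 + β - α - 2 * (n + 1) := by linarith
      positivity
    have hK : ((dualHahnLadder N α β s n).2 / (N - n)) ^ 2 ≤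
        ((dualHahnLadder N α β s n).2 / n) ^ 2 := by
      -- At `n = 0` the quotient by `n` is a division by zero, harmless because `K_0 = 0`.
      rcases Nat.eq_zero_or_pos n with rfl | hpos
      · simp [dualHahnLadder]
      · have hp : (0 : ℝ) < n := by exact_mod_cast hpos
        have hle : (n : ℝ) ≤ N - n := by
          have : ((2 * n : ℕ) : ℝ) ≤ N := by exact_mod_cast (by omega : 2 * n ≤ N)
          push_cast at this
          linarith
        rw [div_pow, div_pow]
        gcongr
    have := mul_le_mul_of_nonneg_left hK (mul_nonneg hs hL)
    linarith

/-! ### The endpoint value and the conclusion. -/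

/-- At `s = L` the factor `s (L - s)` kills the `K_n` term, and `L - (n + 1 + α) = N + β - n` gives
`P_{n+1} = P_n`. -/
theorem dualHahnLadder_top {N n : ℕ} {α β : ℝ} (hβ : -1 < β) (hn : n ≤ N) :
    (dualHahnLadder N α β (N + α + β + 1) n).1 = 1 := by
  induction n with
  | zero => simp [dualHahnLadder]
  | succ n ih =>
    have hn' : (n : ℝ) + 1 ≤ N := by exact_mod_cast hn
    have hB : (N : ℝ) + β - n ≠ 0 := by linarith
    simp only [dualHahnLadder]
    rw [ih (by omega)]
    field_simp
    ring

theorem abs_dualHahnTop {N n : ℕ} {α β : ℝ} (hα : -1 < α) (hβ : -1 < β) (hn : n ≤ N) :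
    |dualHahnTop N α β n| = poch (N + 1 + β - n) n / poch (α + 1) n := by
  induction n with
  | zero => simp [dualHahnTop, poch_zero]
  | succ n ih =>
    have hn' : (n : ℝ) + 1 ≤ N := by exact_mod_cast hn
    have hn0 : (0 : ℝ) ≤ n := n.cast_nonneg
    have hB : 0 < (N : ℝ) + β - n := by linarith
    have hA : 0 < (n : ℝ) + 1 + α := by linarith
    rw [dualHahnTop, abs_mul, abs_neg, abs_of_pos (div_pos hB hA), ih (by omega),
      poch_succ_left, poch_succ (α + 1)]
    push_cast
    rw [show (N : ℝ) + 1 + β - (n + 1) + 1 = N + 1 + β - n by ring, div_mul_div_comm]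
    congr 1 <;> ring

theorem theorem3p9 (N n : ℕ) (α β : ℝ) (hα : -1 < α) (hβ : -1 < β)
    (hN : 0 ≤ N + 1 + β - α) (hnN : n ≤ N)
    (hn : (n : ℝ) ≤ 1 / 2 * min ((N : ℝ) + 2) (N + 1 + β - α)) :
    (∀ x ∈ Set.Icc (0 : ℝ) (N * (N + α + β + 1)),
      |(dualHahn N α β n).eval x| ≤ poch (N + 1 + β - n) n / poch (α + 1) n) ∧
    poch (N + 1 + β - n) n / poch (α + 1) n =
      |(dualHahn N α β n).eval (N * (N + α + β + 1))| := by
  have h1 : 2 * (n : ℝ) ≤ N + 2 := by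
    have := min_le_left ((N : ℝ) + 2) (N + 1 + β - α); linarith
  have h2 : 2 * (n : ℝ) ≤ N + 1 + β - α := by
    have := min_le_right ((N : ℝ) + 2) (N + 1 + β - α); linarith
  have h1' : 2 * n ≤ N + 2 := by exact_mod_cast h1
  rw [← abs_dualHahnTop hα hβ hnN]
  refine ⟨fun x hx => ?_, ?_⟩
  -- The substitution `x = N s` needs `N ≠ 0`; for `N = 0` only `n = 0` occurs.
  · rcases Nat.eq_zero_or_pos N with rfl | hpos
    · obtain rfl : n = 0 := by omega
      simp [dualHahn_eval_zero, dualHahnTop]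
    · have hp : (0 : ℝ) < N := by exact_mod_cast hpos
      obtain ⟨s, rfl⟩ : ∃ s, x = N * s := ⟨x / N, by field_simp⟩
      have hs : 0 ≤ s := nonneg_of_mul_nonneg_right hx.1 hp
      have hs' : s ≤ N + α + β + 1 := le_of_mul_le_mul_left hx.2 hp
      have hE := dualHahnLadder_energy_le_one hβ hs hs' hnN h1' h2
      have hz : 0 ≤ s * (N + α + β + 1 - s) *
          ((dualHahnLadder N α β s n).2 / n) ^ 2 :=
        mul_nonneg (mul_nonneg hs (by linarith)) (sq_nonneg _)
      have hP : |(dualHahnLadder N α β s n).1| ≤ 1 := by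
        rw [← sq_le_one_iff_abs_le_one]; linarith
      rw [dualHahn_eval_eq_top_mul hα hβ s hnN, abs_mul]
      exact mul_le_of_le_one_right (abs_nonneg _) hP
  · rw [dualHahn_eval_eq_top_mul hα hβ _ hnN, dualHahnLadder_top hβ hnN, mul_one]
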